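/- Let $k$ be a field and let $Q$ be a finite quiver (finitely many vertices and arrows). Let $kQ$ be its path algebra, graded by path length, with paths composed from right to left, let $I \subseteq kQ_{\geq 2}$ be a two-sided ideal that is homogeneous for this grading, and give $\Lambda = kQ/I$ the induced grading $\Lambda = \bigoplus_{n \geq 0} \Lambda_n$. Let $d \geq 0$ be an integer, and suppose that - $Q$ is connected, that is, non-empty and such that any two vertices are joined by an unoriented path; - $\Lambda$ has graded length $d+1$, that is, $\Lambda_d \neq 0$ and $\Lambda_i = 0$ for all $i > d$; - $\Lambda$ is graded self-injective, that is, $\Lambda$ is an injective object of the category of $\mathbb{Z}$-graded right $\Lambda$-modules and degree-preserving homomorphisms (this holds in particular if $\Lambda$ is injective as an ungraded right $\Lambda$-module). Then $\Lambda$ is a $d$-graded Frobenius algebra, that is, $\Lambda$ is finite-dimensional over $k$ and there is an isomorphism of graded right $\Lambda$-modules $$\Lambda^* = \operatorname{Hom}_k(\Lambda, k) \cong \Lambda(d),$$ where $(f \cdot a)(b) = f(ab)$ for $f \in \Lambda^*$ and $a, b \in \Lambda$, $(\Lambda^*)_n = \operatorname{Hom}_k(\Lambda_{-n}, k)$ and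 $\Lambda(d)_n = \Lambda_{n+d}$. Moreover, $Q$ is strongly connected: for any two vertices $i, j$ of $Q$ there is an oriented (possibly trivial) path from $i$ to $j$. -/

import Mathlib

/-!
Path algebras of finite quivers, their quotients by homogeneous ideals, graded self-injectivity,
and graded Frobenius algebras.
-/

noncomputable section

universe u v w

/-- A quiver is connected if it is non-empty and any two vertices are joined by an unoriented
path, that is, it has exactly one weakly connected component. -/
def Quiver.IsConnected (Q : Type v) [Quiver.{w} Q] : Prop :=
  Nonempty Q ∧ Subsingleton (Quiver.WeaklyConnectedComponent Q)

/-- All paths of `Q` (including the trivial ones), recorded with source and target. -/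
structure QuiverPath (Q : Type v) [Quiver.{w} Q] where
  /-- the vertex where the path starts -/
  source : Q
  /-- the vertex where the path ends -/
  target : Q
  /-- the path itself -/
  path : Quiver.Path source target

namespace QuiverPath

variable {Q : Type v} [Quiver.{w} Q]

/-- The number of arrows in a path. -/
def length (p : QuiverPath Q) : ℕ := p.path.length

/-- The trivial path at a vertex. -/
def trivial (i : Q) : QuiverPath Q := ⟨i, i, Quiver.Path.nil⟩

/-- The composite "first `q`, then `p`", for `q` ending where `p` starts. -/
def comp (p q : QuiverPath Q) (h : q.target = p.source) : QuiverPath Q :=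
  ⟨q.source, p.target, (h ▸ q.path : Quiver.Path q.source p.source).comp p.path⟩

theorem length_comp (p q : QuiverPath Q) (h : q.target = p.source) :
    (p.comp q h).length = p.length + q.length := by
  obtain ⟨a, b, p⟩ := p
  obtain ⟨c, e, q⟩ := q
  obtain rfl : e = a := h
  simp [comp, length, add_comm]

theorem comp_assoc (p q r : QuiverPath Q) (h : q.target = p.source) (h' : r.target = q.source) :
    (p.comp q h).comp r h' = p.comp (q.comp r h') h := by
  obtain ⟨a, b, p⟩ := p
  obtain ⟨c, e, q⟩ := q
  obtain ⟨f, g, r⟩ := r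
  obtain rfl : e = a := h
  obtain rfl : g = c := h'
  simp [comp]

theorem trivial_comp (q : QuiverPath Q) : (trivial q.target).comp q rfl = q := rfl

theorem comp_trivial (p : QuiverPath Q) : p.comp (trivial p.source) rfl = p := by
  simp [comp, trivial]

end QuiverPath

/-- The path algebra `kQ`: the `k`-vector space with basis the paths of `Q`. The product of two
paths `p * q` is the path "first `q`, then `p`" if `q` ends where `p` starts, and `0` otherwise. -/
def PathAlgebra (k : Type u) (Q : Type v) [Field k] [Quiver.{w} Q] : Type (max u v w) :=
  QuiverPath Q →₀ k

namespace PathAlgebra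

variable (k : Type u) (Q : Type v) [Field k] [Quiver.{w} Q]

instance : AddCommGroup (PathAlgebra k Q) := inferInstanceAs (AddCommGroup (QuiverPath Q →₀ k))

instance : Module k (PathAlgebra k Q) := inferInstanceAs (Module k (QuiverPath Q →₀ k))

/-- The basis of `kQ` consisting of the paths. -/
def basis : Module.Basis (QuiverPath Q) k (PathAlgebra k Q) :=
  Module.Basis.ofRepr (LinearEquiv.refl k (QuiverPath Q →₀ k))

variable {Q}

open Classical in
/-- The product of two paths in the path algebra. -/
def pathMul (p q : QuiverPath Q) : PathAlgebra k Q :=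
  if h : q.target = p.source then basis k Q (p.comp q h) else 0

variable (Q)

/-- The bilinear extension of the product of paths. -/
def mulHom : PathAlgebra k Q →ₗ[k] PathAlgebra k Q →ₗ[k] PathAlgebra k Q :=
  (basis k Q).constr k fun p => (basis k Q).constr k fun q => pathMul k p q

instance : Mul (PathAlgebra k Q) := ⟨fun x y => mulHom k Q x y⟩

/-- The unit is the sum of all trivial paths. -/
instance [Fintype Q] : One (PathAlgebra k Q) := ⟨∑ i : Q, basis k Q (QuiverPath.trivial i)⟩

variable {k Q}

theorem mul_def (x y : PathAlgebra k Q) : x * y = mulHom k Q x y := rfl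

theorem one_def [Fintype Q] :
    (1 : PathAlgebra k Q) = ∑ i : Q, basis k Q (QuiverPath.trivial i) := rfl

theorem basis_mul_basis (p q : QuiverPath Q) :
    basis k Q p * basis k Q q = pathMul k p q := by
  simp [mul_def, mulHom]

theorem mulHom_pathMul (p q r : QuiverPath Q) :
    mulHom k Q (pathMul k p q) (basis k Q r) = mulHom k Q (basis k Q p) (pathMul k q r) := by
  by_cases h : q.target = p.source <;> by_cases h' : r.target = q.source
  · have e1 : pathMul k p q = basis k Q (p.comp q h) := by simp [pathMul, h]
    have e2 : pathMul k q r = basis k Q (q.comp r h') := by simp [pathMul, h']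
    rw [e1, e2, ← mul_def, ← mul_def, basis_mul_basis, basis_mul_basis]
    have h1 : r.target = (p.comp q h).source := h'
    have h2 : (q.comp r h').target = p.source := h
    simp only [pathMul, h1, h2, dif_pos, QuiverPath.comp_assoc p q r h h']
  · have e1 : pathMul k p q = basis k Q (p.comp q h) := by simp [pathMul, h]
    have e2 : pathMul k q r = 0 := by simp [pathMul, h']
    have h1 : ¬ r.target = (p.comp q h).source := h'
    rw [e1, e2, ← mul_def, basis_mul_basis, map_zero]
    simp only [pathMul, h1, dif_neg, not_false_eq_true]
  · have e1 : pathMul k p q = 0 := by simp [pathMul, h]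
    have e2 : pathMul k q r = basis k Q (q.comp r h') := by simp [pathMul, h']
    have h2 : ¬ (q.comp r h').target = p.source := h
    rw [e1, e2, ← mul_def (basis k Q p), basis_mul_basis, map_zero, LinearMap.zero_apply]
    simp only [pathMul, h2, dif_neg, not_false_eq_true]
  · have e1 : pathMul k p q = 0 := by simp [pathMul, h]
    have e2 : pathMul k q r = 0 := by simp [pathMul, h']
    rw [e1, e2, map_zero, map_zero, LinearMap.zero_apply]

protected theorem mul_assoc (x y z : PathAlgebra k Q) : x * y * z = x * (y * z) := by
  have H : (mulHom k Q).compr₂ (mulHom k Q) =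
      ((LinearMap.lcomp k (PathAlgebra k Q →ₗ[k] PathAlgebra k Q) (mulHom k Q)) ∘ₗ
        (LinearMap.llcomp k (PathAlgebra k Q) (PathAlgebra k Q) (PathAlgebra k Q))) ∘ₗ
          mulHom k Q := by
    refine (basis k Q).ext fun p => (basis k Q).ext fun q => (basis k Q).ext fun r => ?_
    change mulHom k Q (basis k Q p * basis k Q q) (basis k Q r) =
      mulHom k Q (basis k Q p) (basis k Q q * basis k Q r)
    rw [basis_mul_basis, basis_mul_basis, mulHom_pathMul]
  exact congrArg (fun f => f x y z) H

protected theorem one_mul [Fintype Q] (x : PathAlgebra k Q) : 1 * x = x := by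
  have H : mulHom k Q 1 = LinearMap.id := by
    refine (basis k Q).ext fun q => ?_
    rw [one_def, map_sum, LinearMap.sum_apply, Finset.sum_eq_single q.target]
    · rw [← mul_def, basis_mul_basis]
      have h : q.target = (QuiverPath.trivial q.target).source := rfl
      rw [pathMul, dif_pos h]
      rfl
    · intro i _ hi
      rw [← mul_def, basis_mul_basis]
      have h : ¬ q.target = (QuiverPath.trivial i).source := fun h => hi h.symm
      simp only [pathMul, h, dif_neg, not_false_eq_true]
    · simp
  exact congrArg (fun f => f x) H

protected theorem mul_one [Fintype Q] (x : PathAlgebra k Q) : x * 1 = x := by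
  have H : (mulHom k Q).flip 1 = LinearMap.id := by
    refine (basis k Q).ext fun q => ?_
    rw [LinearMap.flip_apply, one_def, map_sum, Finset.sum_eq_single q.source]
    · rw [← mul_def, basis_mul_basis]
      have h : (QuiverPath.trivial q.source).target = q.source := rfl
      rw [pathMul, dif_pos h, LinearMap.id_apply]
      exact congrArg _ (QuiverPath.comp_trivial q)
    · intro i _ hi
      rw [← mul_def, basis_mul_basis]
      have h : ¬ (QuiverPath.trivial i).target = q.source := hi
      simp only [pathMul, h, dif_neg, not_false_eq_true]
    · simp
  exact congrArg (fun f => f x) H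

instance [Fintype Q] : Ring (PathAlgebra k Q) where
  __ := (inferInstance : AddCommGroup (PathAlgebra k Q))
  left_distrib x y z := map_add (mulHom k Q x) y z
  right_distrib x y z := by simp [mul_def]
  zero_mul x := by simp [mul_def]
  mul_zero x := by simp [mul_def]
  mul_assoc := PathAlgebra.mul_assoc
  one_mul := PathAlgebra.one_mul
  mul_one := PathAlgebra.mul_one

instance [Fintype Q] : Algebra k (PathAlgebra k Q) :=
  Algebra.ofModule (fun c x y => by simp [mul_def]) (fun c x y => by simp [mul_def])

variable (k Q)

/-- The grading of `kQ` by path length: the degree `n` part is spanned by the paths of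
length `n`. -/
def grading (n : ℕ) : Submodule k (PathAlgebra k Q) :=
  Submodule.span k (basis k Q '' {p | p.length = n})

/-- The subspace `kQ_{≥ n}` spanned by the paths of length at least `n`. -/
def pathsGE (n : ℕ) : Submodule k (PathAlgebra k Q) :=
  Submodule.span k (basis k Q '' {p | n ≤ p.length})

variable {k Q}

theorem basis_mem_grading (p : QuiverPath Q) : basis k Q p ∈ grading k Q p.length :=
  Submodule.subset_span ⟨p, rfl, rfl⟩

theorem mul_mem_grading {m n : ℕ} {x y : PathAlgebra k Q} (hx : x ∈ grading k Q m)
    (hy : y ∈ grading k Q n) : x * y ∈ grading k Q (m + n) := by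
  have h : ∀ x ∈ grading k Q m, ∀ y ∈ grading k Q n, mulHom k Q x y ∈ grading k Q (m + n) := by
    rw [grading, grading, ← Submodule.map₂_le, Submodule.map₂_span_span, Submodule.span_le]
    rintro _ ⟨_, ⟨p, rfl, rfl⟩, _, ⟨q, rfl, rfl⟩, rfl⟩
    change basis k Q p * basis k Q q ∈ _
    rw [basis_mul_basis, pathMul]
    split_ifs with h
    · rw [← QuiverPath.length_comp p q h]
      exact basis_mem_grading _
    · exact Submodule.zero_mem _
  exact h x hx y hy

instance [Fintype Q] : SetLike.GradedMonoid (grading k Q) where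
  one_mem := Submodule.sum_mem _ fun i _ => basis_mem_grading (QuiverPath.trivial i)
  mul_mem _ _ _ _ hx hy := mul_mem_grading hx hy

/-- The map sending an element of `kQ` to the family of its homogeneous components. -/
def decomposeHom : PathAlgebra k Q →ₗ[k] DirectSum ℕ fun n => grading k Q n :=
  (basis k Q).constr k fun p =>
    DirectSum.lof k ℕ (fun n => grading k Q n) p.length ⟨basis k Q p, basis_mem_grading p⟩

theorem decomposeHom_basis (p : QuiverPath Q) : decomposeHom (basis k Q p) =
    DirectSum.lof k ℕ (fun n => grading k Q n) p.length ⟨basis k Q p, basis_mem_grading p⟩ := by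
  simp [decomposeHom]

theorem decomposeHom_of_mem {n : ℕ} (x : PathAlgebra k Q) (hx : x ∈ grading k Q n) :
    decomposeHom x = DirectSum.lof k ℕ (fun n => grading k Q n) n ⟨x, hx⟩ := by
  induction hx using Submodule.span_induction with
  | mem x h =>
    obtain ⟨p, rfl, rfl⟩ := h
    exact decomposeHom_basis p
  | zero => rw [map_zero]; exact (map_zero _).symm
  | add x y hx hy ihx ihy => rw [map_add, ihx, ihy, ← map_add]; rfl
  | smul c x hx ih => rw [map_smul, ih, ← map_smul]; rfl

instance : DirectSum.Decomposition (grading k Q) :=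
  DirectSum.Decomposition.ofLinearMap (grading k Q) decomposeHom
    ((basis k Q).ext fun p => by simp [decomposeHom_basis])
    (DirectSum.linearMap_ext k fun n => LinearMap.ext fun x => by
      simp [decomposeHom_of_mem _ x.2])

instance [Fintype Q] : GradedAlgebra (grading k Q) where

/-- The grading induced on the quotient `kQ/I`: the degree `n` part is the image of the degree `n`
part of `kQ`. -/
def quotientGrading [Fintype Q] (I : Ideal (PathAlgebra k Q)) [I.IsTwoSided] (n : ℕ) :
    Submodule k (PathAlgebra k Q ⧸ I) :=
  (grading k Q n).map (Ideal.Quotient.mkₐ k I).toLinearMap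

end PathAlgebra

section GradedAlgebras

variable {k : Type u} {A : Type v} [Field k] [Ring A] [Algebra k A]

/-- `A = A_0 ⊕ A_1 ⊕ ⋯` has graded length `ℓ` if `ℓ = d + 1` where `d` is the largest degree
with `A_d ≠ 0`. -/
def HasGradedLength (𝒜 : ℕ → Submodule k A) (ℓ : ℕ) : Prop :=
  ∃ d, ℓ = d + 1 ∧ 𝒜 d ≠ ⊥ ∧ ∀ i, d < i → 𝒜 i = ⊥

/-- An `ℕ`-grading, regarded as a `ℤ`-grading which vanishes in negative degrees. -/
def intGrading (𝒜 : ℕ → Submodule k A) : ℤ → Submodule k A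
  | Int.ofNat n => 𝒜 n
  | Int.negSucc _ => ⊥

/-- The family `ℳ` makes the right `A`-module `M` (that is, the left module over the opposite
ring) into a `ℤ`-graded right `A`-module: `M = ⨁ M_n` and `M_n A_i ⊆ M_{n+i}`. -/
structure IsGradedRightModule (𝒜 : ℕ → Submodule k A) {M : Type w} [AddCommGroup M]
    [Module Aᵐᵒᵖ M] (ℳ : ℤ → AddSubgroup M) : Prop where
  isInternal : DirectSum.IsInternal ℳ
  smul_mem : ∀ (n : ℤ) (i : ℕ) (m : M) (a : A), m ∈ ℳ n → a ∈ 𝒜 i →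
    MulOpposite.op a • m ∈ ℳ (n + i)

/-- `A` is graded self-injective: as a right module over itself it is an injective object of the
category of `ℤ`-graded right `A`-modules and degree-preserving homomorphisms. This holds in
particular whenever `A` is injective in the category of all right `A`-modules (replace an arbitrary
extension by its degree-preserving part); for finite-dimensional `A` the two are equivalent. -/
def IsGradedSelfInjective (𝒜 : ℕ → Submodule k A) : Prop :=
  ∀ (X Y : Type v) [AddCommGroup X] [AddCommGroup Y] [Module Aᵐᵒᵖ X] [Module Aᵐᵒᵖ Y]
    (𝒳 : ℤ → AddSubgroup X) (𝒴 : ℤ → AddSubgroup Y),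
    IsGradedRightModule 𝒜 𝒳 → IsGradedRightModule 𝒜 𝒴 →
    ∀ f : X →ₗ[Aᵐᵒᵖ] Y, (∀ n, ∀ x ∈ 𝒳 n, f x ∈ 𝒴 n) → Function.Injective f →
    ∀ g : X →ₗ[Aᵐᵒᵖ] A, (∀ n, ∀ x ∈ 𝒳 n, g x ∈ intGrading 𝒜 n) →
    ∃ h : Y →ₗ[Aᵐᵒᵖ] A, (∀ n, ∀ y ∈ 𝒴 n, h y ∈ intGrading 𝒜 n) ∧ ∀ x, h (f x) = g x

/-- The `ℤ`-grading of the dual `A^* = Hom_k(A, k)`: its degree `n` part is `Hom_k(A_{-n}, k)`,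
the functionals that vanish on `A_i` for all `i ≠ -n`. -/
def dualGrading (𝒜 : ℕ → Submodule k A) (n : ℤ) : Submodule k (Module.Dual k A) where
  carrier := {f | ∀ i : ℕ, (i : ℤ) ≠ -n → ∀ a ∈ 𝒜 i, f a = 0}
  add_mem' hf hg i hi a ha := by simp [hf i hi a ha, hg i hi a ha]
  zero_mem' := by simp
  smul_mem' c f hf i hi a ha := by simp [hf i hi a ha]

/-- `A` is a `d`-graded Frobenius algebra: it is finite-dimensional and there is an isomorphism
`A(d) ≅ A^* = Hom_k(A, k)` of graded right `A`-modules. Here `A` acts on `A^*` on the right by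
`(f · a)(b) = f (a b)`, and the shift `A(d)` has degree `n` part `A_{n+d}`. -/
def IsGradedFrobenius (d : ℕ) (𝒜 : ℕ → Submodule k A) : Prop :=
  Module.Finite k A ∧ ∃ φ : A ≃ₗ[k] Module.Dual k A,
    (∀ x a b : A, φ (x * a) b = φ x (a * b)) ∧
    ∀ (n : ℤ) (x : A), x ∈ intGrading 𝒜 (n + d) ↔ φ x ∈ dualGrading 𝒜 n

end GradedAlgebras

end

/-!
Why the theorem is true. Write `Λ = kQ/I`, and `e_i` for the idempotent of the vertex `i`. As
`I ⊆ kQ_{≥ 2}`, the `e_i` are nonzero, they span `Λ_0`, and arrows are nonzero in `Λ`.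

*Socles.* Let `x ∈ Λ_m` and `y ∈ Λ_n` be nonzero elements of the socle of the right module `Λ` which
span the same simple module up to shift, that is, `x = x e_j` and `y = y e_j`. Graded
self-injectivity, applied to the inclusion of `x Λ` into a shift of `Λ`, gives `c ∈ Λ_{n-m}` with
`y = c x` (`IsGradedSelfInjective.exists_mul_eq`). By symmetry `m = n`, hence `c ∈ Λ_0`; so if
`x` lies in `e_i Λ` and `y` in `e_{i'} Λ`, then `i = i'` and `y` is a multiple of `x`
(`IsGradedSelfInjective.socle_unique`). As `Λ` is bounded above, `e_i Λ` contains nonzero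
socle elements, say at the vertex `ν i`. The uniqueness makes `ν` injective, so it is a permutation,
and so `e_i Λ` has a one-dimensional essential socle, spanned by some `s_i ∈ e_i Λ e_{ν i}` of
degree `δ i` (`IsGradedSelfInjective.nonempty_socleData`).

*Strong connectivity.* As `s_i ≠ 0`, there is a path from `ν i` to `i`; going around the cycles of
the permutation `ν`, there also is a path from `i` to `ν i`. For an arrow `a : i ⟶ j` essentiality
gives `b ∈ e_i Λ e_{ν j}` with `a b = s_j`, so there are paths from `j` to `ν j` and on to `i`.
Hence all arrows can be reversed by paths, and connected implies strongly connected
(`PathAlgebra.isStronglyConnected`).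

*Degrees.* The element `b` has degree `δ j - 1`, which is at most `δ i`. If it were equal to `δ i`,
then `b` would lie in the socle of `e_i Λ`, so that `ν i = ν j` and `i = j`, which is absurd. Hence
`δ j ≤ δ i` for every arrow (`SocleData.degree_le_of_arrow`), and `δ` is constant by strong
connectivity; its value is the top degree `d` (`PathAlgebra.degree_eq`).

*Frobenius form.* A linear functional `l` on `Λ_d` with `l (s_i) = 1` for all `i`, extended by zero,
gives the nondegenerate pairing `l (x y)`, and `x ↦ l (x ·)` is the required isomorphism
(`SocleData.isGradedFrobenius`).
-/

open DirectSum

/-! ### Gradings and shifts -/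

/-- Relabelling the pieces of an internal direct sum and filling up with zero again gives an
internal direct sum. The relabelling need not be injective: pieces which acquire the same label are
equal, hence zero by independence. -/
theorem DirectSum.IsInternal.relabel {R M ι κ : Type*} [Ring R] [AddCommGroup M] [Module R M]
    [DecidableEq ι] [DecidableEq κ] {ℳ : ι → Submodule R M} {𝒩 : κ → Submodule R M}
    (h : IsInternal ℳ) {σ : ι → κ} (h₁ : ∀ i, 𝒩 (σ i) = ℳ i)
    (h₂ : ∀ j, j ∉ Set.range σ → 𝒩 j = ⊥) : IsInternal 𝒩 := by
  rw [isInternal_submodule_iff_iSupIndep_and_iSup_eq_top] at h ⊢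
  constructor
  · rw [← iSupIndep_ne_bot]
    have hr : ∀ j : {j // 𝒩 j ≠ ⊥}, ∃ i, σ i = j := fun j => by
      by_contra hj
      exact j.2 (h₂ _ hj)
    choose g hg using hr
    have hgi : Function.Injective g := fun a b hab => Subtype.ext (by rw [← hg, ← hg, hab])
    have e : (fun j : {j // 𝒩 j ≠ ⊥} => 𝒩 j) = ℳ ∘ g := by
      funext j
      rw [Function.comp_apply, ← h₁, hg]
    rw [e]
    exact h.1.comp hgi
  · rw [eq_top_iff, ← h.2]
    exact iSup_le fun i => (h₁ i).symm.le.trans (le_iSup 𝒩 (σ i))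

section Graded

variable {k : Type u} {A : Type v} [Field k] [Ring A] [Algebra k A] (𝒜 : ℕ → Submodule k A)

theorem intGrading_natCast (n : ℕ) : intGrading 𝒜 n = 𝒜 n := rfl

theorem intGrading_of_neg {n : ℤ} (hn : n < 0) : intGrading 𝒜 n = ⊥ := by
  obtain ⟨m, rfl⟩ := Int.eq_negSucc_of_lt_zero hn
  rfl

variable [GradedAlgebra 𝒜]

/-- The shifted regular module `A(s)` is a graded right module. -/
theorem isGradedRightModule_shift (s : ℤ) :
    IsGradedRightModule 𝒜 (fun n => (intGrading 𝒜 (n + s)).toAddSubgroup) where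
  isInternal := by
    have h : IsInternal (fun n : ℤ => intGrading 𝒜 (n + s)) := by
      refine (Decomposition.isInternal 𝒜).relabel (σ := fun i : ℕ => (i : ℤ) - s)
        (fun i => by simp [intGrading_natCast]) ?_
      intro j hj
      refine intGrading_of_neg 𝒜 ?_
      by_contra! hn
      exact hj ⟨(j + s).toNat, by simp [Int.toNat_of_nonneg hn]⟩
    exact h
  smul_mem n i m a hm ha := by
    change m * a ∈ intGrading 𝒜 (n + i + s)
    change m ∈ intGrading 𝒜 (n + s) at hm
    rcases lt_or_ge (n + s) 0 with hn | hn
    · rw [intGrading_of_neg 𝒜 hn, Submodule.mem_bot] at hm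
      rw [hm, zero_mul]
      exact zero_mem _
    · obtain ⟨N, hN⟩ := Int.eq_ofNat_of_zero_le hn
      rw [hN, intGrading_natCast] at hm
      rw [show n + i + s = ((N + i : ℕ) : ℤ) by push_cast; omega, intGrading_natCast]
      exact SetLike.mul_mem_graded hm ha

/-- If `x` and `y` are homogeneous elements on which `A` acts from the right through one and the
same character `χ`, and `χ` vanishes in positive degrees, then graded self-injectivity extends the
isomorphism `x A ≅ y A` of simple right ideals to a homogeneous endomorphism of the right module
`A`, that is, to left multiplication by some homogeneous `c`. In particular, the degree of `y` is at
least that of `x`. -/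
theorem IsGradedSelfInjective.exists_mul_eq (hinj : IsGradedSelfInjective 𝒜) {x y : A} {m n : ℕ}
    (hx : x ∈ 𝒜 m) (hy : y ∈ 𝒜 n) (hx₀ : x ≠ 0) (hy₀ : y ≠ 0) (χ : A → k)
    (hχ : ∀ i, 0 < i → ∀ a ∈ 𝒜 i, χ a = 0) (hxχ : ∀ a, x * a = χ a • x)
    (hyχ : ∀ a, y * a = χ a • y) : ∃ s, m + s = n ∧ ∃ c ∈ 𝒜 s, c * x = y := by
  -- The right ideal `x A = k x`, with the homomorphism `g` to `A` sending `x` to `y`.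
  let X : Submodule Aᵐᵒᵖ A :=
    { carrier := {z | ∃ t : k, z = t • x}
      add_mem' := by
        rintro _ _ ⟨t, rfl⟩ ⟨t', rfl⟩
        exact ⟨t + t', (add_smul _ _ _).symm⟩
      zero_mem' := ⟨0, (zero_smul _ _).symm⟩
      smul_mem' := by
        rintro a _ ⟨t, rfl⟩
        refine ⟨t * χ a.unop, ?_⟩
        change (t • x) * a.unop = _
        rw [smul_mul_assoc, hxχ, smul_smul] }
  obtain ⟨ξ, hξ⟩ : ∃ ξ : Module.Dual k A, ξ x = 1 := Module.Projective.exists_dual_eq_one k hx₀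
  let g : X →ₗ[Aᵐᵒᵖ] A :=
    { toFun := fun z => ξ z.1 • y
      map_add' := fun z z' => by simp [add_smul]
      map_smul' := by
        rintro a ⟨_, t, rfl⟩
        change ξ ((t • x) * a.unop) • y = (ξ (t • x) • y) * a.unop
        simp only [smul_mul_assoc, hxχ, hyχ, map_smul, hξ, smul_eq_mul, mul_one, smul_smul] }
  have hgx : g ⟨x, 1, (one_smul _ _).symm⟩ = y := by
    change ξ x • y = y
    rw [hξ, one_smul]
  -- `X` is put in degree `n`, where `y` lives; the shift of `A` below moves `x` to this degree.
  let 𝒳 : ℤ → Submodule Aᵐᵒᵖ X := fun j => if j = n then ⊤ else ⊥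
  have h𝒳 : IsGradedRightModule 𝒜 (fun j => (𝒳 j).toAddSubgroup) := by
    refine ⟨?_, ?_⟩
    · have h : IsInternal 𝒳 := by
        have h₀ : IsInternal (fun _ : Unit => (⊤ : Submodule Aᵐᵒᵖ X)) := by
          rw [isInternal_submodule_iff_iSupIndep_and_iSup_eq_top]
          exact ⟨iSupIndep_subsingleton _, by simp⟩
        refine h₀.relabel (σ := fun _ => (n : ℤ)) (fun _ => if_pos rfl)
          fun j hj => if_neg fun h => hj ⟨(), h.symm⟩
      exact h
    · rintro j i ⟨_, t, rfl⟩ a hz ha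
      change MulOpposite.op a • _ ∈ 𝒳 (j + i)
      rcases Nat.eq_zero_or_pos i with rfl | hi
      · rw [Nat.cast_zero, add_zero]
        exact Submodule.smul_mem _ _ hz
      · suffices h : MulOpposite.op a • (⟨t • x, t, rfl⟩ : X) = 0 from h ▸ Submodule.zero_mem _
        refine Subtype.ext ?_
        change (t • x) * a = 0
        rw [smul_mul_assoc, hxχ, hχ i hi a ha, zero_smul, smul_zero]
  obtain ⟨h, hdeg, hh⟩ := hinj X A _ _ h𝒳 (isGradedRightModule_shift 𝒜 ((m : ℤ) - n)) X.subtype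
    (by
      rintro j ⟨_, t, rfl⟩ hz
      change t • x ∈ intGrading 𝒜 (j + (m - n))
      change _ ∈ (if j = n then ⊤ else ⊥ : Submodule Aᵐᵒᵖ X) at hz
      split_ifs at hz with hj
      · rw [hj, show (n : ℤ) + (m - n) = m by omega, intGrading_natCast]
        exact Submodule.smul_mem _ _ hx
      · rw [Submodule.mem_bot, Subtype.ext_iff] at hz
        rw [show t • x = 0 from hz]
        exact zero_mem _)
    X.injective_subtype g
    (by
      intro j z hz
      change ξ z.1 • y ∈ intGrading 𝒜 j
      change z ∈ (if j = n then ⊤ else ⊥ : Submodule Aᵐᵒᵖ X) at hz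
      split_ifs at hz with hj
      · rw [hj, intGrading_natCast]
        exact Submodule.smul_mem _ _ hy
      · rw [Submodule.mem_bot] at hz
        simp [hz])
  have hc : h 1 * x = y := by
    rw [← hgx, ← hh]
    change h 1 * x = h x
    rw [← op_smul_eq_mul, ← map_smul, op_smul_eq_mul, one_mul]
  have h1 : h 1 ∈ intGrading 𝒜 (n - m) := by
    refine hdeg _ _ ?_
    change (1 : A) ∈ intGrading 𝒜 (n - m + (m - n))
    rw [show (n : ℤ) - m + (m - n) = (0 : ℕ) by simp, intGrading_natCast]
    exact SetLike.one_mem_graded 𝒜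
  rcases lt_or_ge ((n : ℤ) - m) 0 with hn | hn
  · rw [intGrading_of_neg 𝒜 hn, Submodule.mem_bot] at h1
    exact absurd (by rw [← hc, h1, zero_mul]) hy₀
  · obtain ⟨s, hs⟩ := Int.eq_ofNat_of_zero_le hn
    rw [hs, intGrading_natCast] at h1
    exact ⟨s, by omega, h 1, h1, hc⟩

end Graded

/-! ### The socle of a graded self-injective algebra -/

section Socle

variable {k : Type u} {A : Type v} [Field k] [Ring A] [Algebra k A] (𝒜 : ℕ → Submodule k A)

/-- An element of the `ℕ`-graded algebra `A` which is annihilated from the right by all elements of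
positive degree. If `A_0` is semisimple and the grading is bounded, then these elements form the
socle of the right module `A`. -/
def IsRightSocle (x : A) : Prop :=
  ∀ n, 0 < n → ∀ a ∈ 𝒜 n, x * a = 0

variable {𝒜} {Q : Type w} {e : Q → A}

/-- Data describing the socle of a graded self-injective algebra with vertices `Q`: every `e_i A`
has a simple essential socle `s_i k`, in degree `δ i`, and isomorphic to the simple module at
`ν i`; the Nakayama permutation `ν` is injective. -/
structure SocleData (𝒜 : ℕ → Submodule k A) (e : Q → A) where
  /-- the Nakayama permutation -/
  ν : Q → Q
  /-- the degree of the socle of `e_i A` -/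
  δ : Q → ℕ
  /-- a generator of the socle of `e_i A` -/
  s : Q → A
  ν_injective : Function.Injective ν
  s_mem : ∀ i, s i ∈ 𝒜 (δ i)
  s_ne_zero : ∀ i, s i ≠ 0
  mul_s : ∀ i, e i * s i = s i
  s_mul : ∀ i, s i * e (ν i) = s i
  exists_mul_eq : ∀ i n x, x ∈ 𝒜 n → x ≠ 0 → e i * x = x →
    ∃ m, n + m = δ i ∧ ∃ b ∈ 𝒜 m, b * e (ν i) = b ∧ x * b = s i

theorem SocleData.le_degree (S : SocleData 𝒜 e) {i : Q} {n : ℕ} {x : A}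
    (hx : x ∈ 𝒜 n) (hx₀ : x ≠ 0) (hxi : e i * x = x) : n ≤ S.δ i := by
  obtain ⟨m, hm, -⟩ := S.exists_mul_eq i n x hx hx₀ hxi
  omega

variable [Fintype Q]

theorem exists_mul_ne_zero_right (he : CompleteOrthogonalIdempotents e) {x : A} (hx : x ≠ 0) :
    ∃ j, x * e j ≠ 0 := by
  by_contra! h
  exact hx (by rw [← mul_one x, ← he.complete, Finset.mul_sum, Finset.sum_eq_zero fun j _ => h j])

theorem exists_mul_ne_zero_left (he : CompleteOrthogonalIdempotents e) {x : A} (hx : x ≠ 0) :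
    ∃ i, e i * x ≠ 0 := by
  by_contra! h
  exact hx (by rw [← one_mul x, ← he.complete, Finset.sum_mul, Finset.sum_eq_zero fun j _ => h j])

theorem mul_eq_smul_of_mem_zero (he : CompleteOrthogonalIdempotents e)
    (h₀ : 𝒜 0 = Submodule.span k (Set.range e)) (j : Q) {a : A} (ha : a ∈ 𝒜 0) :
    ∃ t : k, a * e j = t • e j ∧ e j * a = t • e j := by
  rw [h₀] at ha
  classical
  induction ha using Submodule.span_induction with
  | mem x h =>
    obtain ⟨i, rfl⟩ := h
    by_cases hij : i = j
    · subst hij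
      exact ⟨1, by rw [he.idem i, one_smul], by rw [he.idem i, one_smul]⟩
    · exact ⟨0, by rw [he.ortho hij, zero_smul], by rw [he.ortho (Ne.symm hij), zero_smul]⟩
  | zero => exact ⟨0, by simp, by simp⟩
  | add x y hx hy ihx ihy =>
    obtain ⟨s, hs, hs'⟩ := ihx
    obtain ⟨t, ht, ht'⟩ := ihy
    exact ⟨s + t, by rw [add_mul, hs, ht, add_smul], by rw [mul_add, hs', ht', add_smul]⟩
  | smul c x hx ih =>
    obtain ⟨s, hs, hs'⟩ := ih
    exact ⟨c * s, by rw [smul_mul_assoc, hs, smul_smul], by rw [mul_smul_comm, hs', smul_smul]⟩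

/-- The top degree of `e_i A` is concentrated at the vertex `ν i`. -/
theorem SocleData.eq_of_top_degree (S : SocleData 𝒜 e) (he : CompleteOrthogonalIdempotents e)
    (h₀ : 𝒜 0 = Submodule.span k (Set.range e)) {i j : Q} {x : A} (hx : x ∈ 𝒜 (S.δ i))
    (hx₀ : x ≠ 0) (hxi : e i * x = x) (hxj : x * e j = x) : j = S.ν i := by
  obtain ⟨m, hm, b, hb, hbν, hxb⟩ := S.exists_mul_eq i _ x hx hx₀ hxi
  obtain rfl : m = 0 := by omega
  obtain ⟨t, ht, -⟩ := mul_eq_smul_of_mem_zero he h₀ (S.ν i) hb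
  by_contra hne
  apply S.s_ne_zero i
  rw [← hxb, ← hbν, ht, ← hxj, mul_smul_comm, mul_assoc, he.ortho hne, mul_zero, smul_zero]

variable [GradedAlgebra 𝒜]

theorem IsRightSocle.mul_eq {x : A} (hx : IsRightSocle 𝒜 x) (a : A) :
    x * a = x * (decompose 𝒜 a 0 : A) := by
  induction a using Decomposition.inductionOn 𝒜 with
  | zero => simp
  | @homogeneous i a =>
    rcases Nat.eq_zero_or_pos i with rfl | hi
    · rw [decompose_of_mem_same 𝒜 a.2]
    · rw [decompose_of_mem_ne 𝒜 a.2 hi.ne', mul_zero, hx i hi a a.2]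
  | add a b ha hb => rw [decompose_add, DirectSum.add_apply, Submodule.coe_add, mul_add, mul_add,
      ha, hb]

/-- `e_j a = χ(a) e_j` modulo elements of positive degree, for a function `χ`. -/
theorem exists_character (he : CompleteOrthogonalIdempotents e)
    (h₀ : 𝒜 0 = Submodule.span k (Set.range e)) (j : Q) (hj : e j ≠ 0) :
    ∃ χ : A → k, (∀ i, 0 < i → ∀ a ∈ 𝒜 i, χ a = 0) ∧
      ∀ x, IsRightSocle 𝒜 x → x * e j = x → ∀ a, x * a = χ a • x := by
  choose χ _ hχ using fun a : A =>
    mul_eq_smul_of_mem_zero he h₀ j (a := (decompose 𝒜 a 0 : A)) (SetLike.coe_mem _)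
  refine ⟨χ, fun i hi a ha => ?_, fun x hx hxj a => ?_⟩
  · have h := hχ a
    rw [decompose_of_mem_ne 𝒜 ha hi.ne', mul_zero] at h
    exact (smul_eq_zero.1 h.symm).resolve_right hj
  · rw [hx.mul_eq, ← hxj, mul_assoc, hχ, mul_smul_comm]

/-- In a graded self-injective algebra a simple right module occurs at most once in the socle. -/
theorem IsGradedSelfInjective.socle_unique (hinj : IsGradedSelfInjective 𝒜)
    (he : CompleteOrthogonalIdempotents e) (h₀ : 𝒜 0 = Submodule.span k (Set.range e))
    {x y : A} {m n : ℕ} {i i' j : Q} (hx : x ∈ 𝒜 m) (hy : y ∈ 𝒜 n) (hx₀ : x ≠ 0) (hy₀ : y ≠ 0)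
    (hxs : IsRightSocle 𝒜 x) (hys : IsRightSocle 𝒜 y) (hxi : e i * x = x) (hyi : e i' * y = y)
    (hxj : x * e j = x) (hyj : y * e j = y) : i = i' ∧ m = n ∧ ∃ t : k, y = t • x := by
  have hj : e j ≠ 0 := fun h => hx₀ (by rw [← hxj, h, mul_zero])
  obtain ⟨χ, hχ, hχ'⟩ := exists_character he h₀ j hj
  have hxχ := hχ' x hxs hxj
  have hyχ := hχ' y hys hyj
  obtain ⟨s, hs, c, hc, hcx⟩ := hinj.exists_mul_eq 𝒜 hx hy hx₀ hy₀ χ hχ hxχ hyχ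
  obtain ⟨s', hs', -⟩ := hinj.exists_mul_eq 𝒜 hy hx hy₀ hx₀ χ hχ hyχ hxχ
  obtain rfl : s = 0 := by omega
  obtain ⟨t, ht, -⟩ := mul_eq_smul_of_mem_zero he h₀ i hc
  have hyx : y = t • x := by
    rw [← hcx]
    conv_lhs => rw [← hxi, ← mul_assoc, ht, smul_mul_assoc, hxi]
  refine ⟨?_, by omega, t, hyx⟩
  by_contra hne
  apply hy₀
  rw [← hyi, hyx, ← hxi, mul_smul_comm, ← mul_assoc, he.ortho (Ne.symm hne), zero_mul, smul_zero]

/-- If the grading is bounded, then the socle is essential: multiply `x` by a homogeneous element of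
the largest possible degree which does not kill it. -/
theorem exists_mul_isRightSocle (he : CompleteOrthogonalIdempotents e)
    (h₀ : 𝒜 0 = Submodule.span k (Set.range e)) {d : ℕ} (hd : ∀ i, d < i → 𝒜 i = ⊥) {x : A}
    (hx : x ≠ 0) :
    ∃ m, ∃ b ∈ 𝒜 m, ∃ j, b * e j = b ∧ x * b ≠ 0 ∧ IsRightSocle 𝒜 (x * b) := by
  classical
  have he₀ : ∀ j, e j ∈ 𝒜 0 := fun j => h₀ ▸ Submodule.subset_span ⟨j, rfl⟩
  let P : ℕ → Prop := fun m => ∃ b ∈ 𝒜 m, x * b ≠ 0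
  have hP₀ : P 0 := ⟨1, SetLike.one_mem_graded 𝒜, by rwa [mul_one]⟩
  obtain ⟨b, hb, hxb⟩ : P (Nat.findGreatest P d) := Nat.findGreatest_spec (Nat.zero_le d) hP₀
  obtain ⟨j, hj⟩ := exists_mul_ne_zero_right he hxb
  refine ⟨_, b * e j, SetLike.mul_mem_graded hb (he₀ j), j, by rw [mul_assoc, he.idem j],
    by rwa [← mul_assoc], fun n hn a ha => ?_⟩
  by_contra hne
  have hmem : b * e j * a ∈ 𝒜 (Nat.findGreatest P d + 0 + n) :=
    SetLike.mul_mem_graded (SetLike.mul_mem_graded hb (he₀ j)) ha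
  rw [mul_assoc] at hne
  have hle : Nat.findGreatest P d + 0 + n ≤ d := by
    by_contra! hlt
    rw [hd _ hlt, Submodule.mem_bot] at hmem
    exact hne (by rw [hmem, mul_zero])
  have := Nat.le_findGreatest (P := P) hle ⟨_, hmem, hne⟩
  omega

theorem IsGradedSelfInjective.nonempty_socleData (hinj : IsGradedSelfInjective 𝒜)
    (he : CompleteOrthogonalIdempotents e) (h₀ : 𝒜 0 = Submodule.span k (Set.range e))
    (hne : ∀ i, e i ≠ 0) {d : ℕ} (hd : ∀ i, d < i → 𝒜 i = ⊥) : Nonempty (SocleData 𝒜 e) := by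
  have H : ∀ i n x, x ∈ 𝒜 n → x ≠ 0 → e i * x = x → ∃ m, ∃ b ∈ 𝒜 m, ∃ j,
      b * e j = b ∧ x * b ∈ 𝒜 (n + m) ∧ x * b ≠ 0 ∧ IsRightSocle 𝒜 (x * b) ∧
        e i * (x * b) = x * b ∧ x * b * e j = x * b := by
    intro i n x hx hx₀ hxi
    obtain ⟨m, b, hb, j, hbj, hxb, hs⟩ := exists_mul_isRightSocle he h₀ hd hx₀
    exact ⟨m, b, hb, j, hbj, SetLike.mul_mem_graded hx hb, hxb, hs, by rw [← mul_assoc, hxi],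
      by rw [mul_assoc, hbj]⟩
  choose δ b _ ν _ hδ hs₀ hs hes hse using fun i =>
    H i 0 (e i) (h₀ ▸ Submodule.subset_span ⟨i, rfl⟩) (hne i) (he.idem i)
  have hν : Function.Injective ν := fun i i' h =>
    (hinj.socle_unique he h₀ (hδ i) (hδ i') (hs₀ i) (hs₀ i') (hs i) (hs i') (hes i) (hes i')
      (hse i) (by rw [h]; exact hse i')).1
  refine ⟨⟨ν, fun i => 0 + δ i, fun i => e i * b i, hν, hδ, hs₀, hes, hse, ?_⟩⟩
  intro i n x hx hx₀ hxi
  obtain ⟨m, c, hc, j, hcj, hmem, hxc, hxs, hxi', hxj⟩ := H i n x hx hx₀ hxi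
  -- By finiteness `ν` is surjective, so that every simple module occurs in the socle.
  obtain ⟨i', rfl⟩ := (Finite.injective_iff_surjective.1 hν) j
  obtain ⟨rfl, hm, t, ht⟩ := hinj.socle_unique he h₀ hmem (hδ i') hxc (hs₀ i') hxs (hs i') hxi'
    (hes i') hxj (hse i')
  exact ⟨m, hm, t • c, Submodule.smul_mem _ _ hc, by rw [smul_mul_assoc, hcj],
    by rw [mul_smul_comm, ht]⟩

namespace SocleData

variable (S : SocleData 𝒜 e)

/-- A nonzero element `a` of degree one from the vertex `i` to the vertex `j` multiplies some
element of `e_i A e_{ν j}` to the socle of `e_j A`. The degree of this element is smaller than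
`δ i`: otherwise it would belong to the socle of `e_i A`, which is located at `ν i`. -/
theorem degree_le_of_arrow (he : CompleteOrthogonalIdempotents e)
    (h₀ : 𝒜 0 = Submodule.span k (Set.range e)) {i j : Q} {a : A} (ha : a ∈ 𝒜 1) (ha₀ : a ≠ 0)
    (haj : e j * a = a) (hai : a * e i = a) :
    S.δ j ≤ S.δ i ∧ ∃ m, ∃ b ∈ 𝒜 m, e i * b * e (S.ν j) ≠ 0 := by
  obtain ⟨m, hm, b, hb, hbν, hab⟩ := S.exists_mul_eq j 1 a ha ha₀ haj
  have hb₀ : e i * b ≠ 0 := fun h => S.s_ne_zero j (by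
    rw [← hab, ← hai, mul_assoc, h, mul_zero])
  have hbm : e i * b ∈ 𝒜 m := by
    have := SetLike.mul_mem_graded (A := 𝒜)
      (h₀.symm ▸ Submodule.subset_span ⟨i, rfl⟩ : e i ∈ 𝒜 0) hb
    rwa [zero_add] at this
  have hib : e i * (e i * b) = e i * b := by rw [← mul_assoc, he.idem i]
  have hbν' : e i * b * e (S.ν j) = e i * b := by rw [mul_assoc, hbν]
  have hle := S.le_degree hbm hb₀ hib
  refine ⟨?_, m, b, hb, by rwa [hbν']⟩
  rcases hle.lt_or_eq with hlt | rfl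
  · omega
  · exact (congrArg S.δ (S.ν_injective (S.eq_of_top_degree he h₀ hbm hb₀ hib hbν'))).le

end SocleData

end Socle

/-! ### The Frobenius form -/

section Frobenius

variable {k : Type u} {A : Type v} [Field k] [Ring A] [Algebra k A] {𝒜 : ℕ → Submodule k A}
  [GradedAlgebra 𝒜] {Q : Type w} [Fintype Q] {e : Q → A}

namespace SocleData

variable (S : SocleData 𝒜 e)

/-- There is a linear functional of degree `-d` which takes the value `1` on all the chosen
generators of the socle. -/
theorem exists_functional (he : CompleteOrthogonalIdempotents e) {d : ℕ} (hδ : ∀ i, S.δ i = d) :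
    ∃ l : A →ₗ[k] k, (∀ i, l (S.s i) = 1) ∧ ∀ x, l x = l (decompose 𝒜 x d : A) := by
  choose ψ hψ using fun i => Module.Projective.exists_dual_eq_one k (S.s_ne_zero i)
  let l : A →ₗ[k] k := ∑ i, ψ i ∘ₗ LinearMap.mulLeft k (e i)
  have hl : ∀ i, l (S.s i) = 1 := fun i => by
    rw [LinearMap.sum_apply, Finset.sum_eq_single i]
    · rw [LinearMap.comp_apply, LinearMap.mulLeft_apply, S.mul_s, hψ]
    · intro j _ hj
      rw [LinearMap.comp_apply, LinearMap.mulLeft_apply, ← S.mul_s, ← mul_assoc, he.ortho hj,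
        zero_mul, map_zero]
    · simp
  refine ⟨l ∘ₗ GradedAlgebra.proj 𝒜 d, fun i => ?_, fun x => ?_⟩
  · rw [LinearMap.comp_apply, GradedAlgebra.proj_apply,
      decompose_of_mem_same 𝒜 (hδ i ▸ S.s_mem i), hl]
  · simp only [LinearMap.comp_apply, GradedAlgebra.proj_apply]
    rw [decompose_of_mem_same 𝒜 (SetLike.coe_mem (decompose 𝒜 x d))]

/-- Any nonzero homogeneous element can be multiplied to one of the generators of the socle.
Starting from `e_i x`, the other `e_l x` are killed, since the Nakayama permutation is injective. -/
theorem exists_mul_eq_s (he : CompleteOrthogonalIdempotents e)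
    (h₀ : 𝒜 0 = Submodule.span k (Set.range e)) {d : ℕ} (hδ : ∀ i, S.δ i = d) {n : ℕ} {x : A}
    (hx : x ∈ 𝒜 n) (hx₀ : x ≠ 0) : ∃ m, n + m = d ∧ ∃ b ∈ 𝒜 m, ∃ i, x * b = S.s i := by
  have hmem : ∀ l n (y : A), y ∈ 𝒜 n → e l * y ∈ 𝒜 n := fun l n y hy => by
    have := SetLike.mul_mem_graded (A := 𝒜)
      (h₀.symm ▸ Submodule.subset_span ⟨l, rfl⟩ : e l ∈ 𝒜 0) hy
    rwa [zero_add] at this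
  obtain ⟨i, hi⟩ := exists_mul_ne_zero_left he hx₀
  obtain ⟨m, hm, b, hb, hbν, hxb⟩ := S.exists_mul_eq i n (e i * x) (hmem _ _ _ hx) hi
    (by rw [← mul_assoc, he.idem i])
  rw [hδ] at hm
  refine ⟨m, hm, b, hb, i, ?_⟩
  rw [← one_mul (x * b), ← he.complete, Finset.sum_mul, Finset.sum_eq_single i]
  · rw [← mul_assoc, hxb]
  · intro l _ hl
    by_contra hne
    refine hl (S.ν_injective (S.eq_of_top_degree he h₀ (i := l) (j := S.ν i)
      (x := e l * (x * b)) ?_ hne ?_ ?_)).symm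
    · rw [hδ, ← hm]
      exact hmem _ _ _ (SetLike.mul_mem_graded hx hb)
    · rw [← mul_assoc, he.idem l]
    · rw [mul_assoc, mul_assoc, hbν]
  · simp

/-- If the socles of all the modules `e_i A` are in the same degree `d`, then the functional `l` of
`SocleData.exists_functional` is a Frobenius form of degree `-d`: the pairing `l (x * y)` is
nondegenerate, and pairs `A_n` with `A_{d-n}`. -/
theorem isGradedFrobenius [Module.Finite k A] (he : CompleteOrthogonalIdempotents e)
    (h₀ : 𝒜 0 = Submodule.span k (Set.range e)) {d : ℕ} (hδ : ∀ i, S.δ i = d) :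
    IsGradedFrobenius d 𝒜 := by
  obtain ⟨l, hls, hld⟩ := S.exists_functional he hδ
  have hnd : ∀ x n, (decompose 𝒜 x n : A) ≠ 0 → ∃ m, n + m = d ∧ ∃ b ∈ 𝒜 m, l (x * b) ≠ 0 := by
    intro x n hn
    obtain ⟨m, hm, b, hb, i, hi⟩ := S.exists_mul_eq_s he h₀ hδ (SetLike.coe_mem _) hn
    refine ⟨m, hm, b, hb, ?_⟩
    rw [hld, ← hm, coe_decompose_mul_add_of_right_mem 𝒜 hb, hi, hls]
    exact one_ne_zero
  have hcomp : ∀ x : A, x ≠ 0 → ∃ n, (decompose 𝒜 x n : A) ≠ 0 := by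
    intro x hx
    by_contra! h
    refine hx ((decompose 𝒜).injective ?_)
    rw [decompose_zero]
    exact DFinsupp.ext fun n => Subtype.ext (h n)
  let f : A →ₗ[k] Module.Dual k A := (LinearMap.mul k A).compr₂ l
  have hf : ∀ x b, f x b = l (x * b) := fun x b => rfl
  have hinj : Function.Injective f := by
    rw [← LinearMap.ker_eq_bot, LinearMap.ker_eq_bot']
    intro x hx
    by_contra hne
    obtain ⟨n, hn⟩ := hcomp x hne
    obtain ⟨m, -, b, -, hb⟩ := hnd x n hn
    exact hb (by rw [← hf, hx, LinearMap.zero_apply])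
  refine ⟨inferInstance, f.linearEquivOfInjective hinj Subspace.dual_finrank_eq.symm, ?_, ?_⟩
  · intro x a b
    simp only [LinearMap.linearEquivOfInjective_apply, hf, mul_assoc]
  · intro n x
    rw [LinearMap.linearEquivOfInjective_apply]
    constructor
    · intro hx i hi a ha
      rw [hf, hld]
      rcases lt_or_ge (n + d) 0 with hn | hn
      · rw [intGrading_of_neg 𝒜 hn, Submodule.mem_bot] at hx
        simp [hx]
      · obtain ⟨N, hN⟩ := Int.eq_ofNat_of_zero_le hn
        rw [hN, intGrading_natCast] at hx
        rw [decompose_of_mem_ne 𝒜 (SetLike.mul_mem_graded hx ha) (by omega), map_zero]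
    · intro hx
      have hz : ∀ m : ℕ, (m : ℤ) ≠ n + d → (decompose 𝒜 x m : A) = 0 := by
        intro m hm
        by_contra hne
        obtain ⟨m', hm', b, hb, hlb⟩ := hnd x m hne
        exact hlb (hx m' (by omega) b hb)
      rcases lt_or_ge (n + d) 0 with hn | hn
      · rw [intGrading_of_neg 𝒜 hn, Submodule.mem_bot]
        by_contra hne
        obtain ⟨m, hm⟩ := hcomp x hne
        exact hm (hz m (by omega))
      · obtain ⟨N, hN⟩ := Int.eq_ofNat_of_zero_le hn
        rw [hN, intGrading_natCast]
        have hxN : x = (decompose 𝒜 x N : A) := by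
          refine (decompose 𝒜).injective (DFinsupp.ext fun m => Subtype.ext ?_)
          by_cases hm : m = N
          · subst hm
            rw [decompose_of_mem_same 𝒜 (SetLike.coe_mem _)]
          · rw [decompose_of_mem_ne 𝒜 (SetLike.coe_mem _) (Ne.symm hm)]
            exact hz m (by omega)
        rw [hxN]
        exact SetLike.coe_mem _

end SocleData

end Frobenius

/-! ### Quotients of path algebras -/

/-- A finite quiver has only finitely many paths of a given length. -/
theorem QuiverPath.finite_setOf_length_eq {Q : Type v} [Quiver.{w} Q] [Finite Q]
    [∀ i j : Q, Finite (i ⟶ j)] (n : ℕ) : {p : QuiverPath Q | p.length = n}.Finite := by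
  induction n with
  | zero =>
    refine (Set.finite_range (QuiverPath.trivial (Q := Q))).subset ?_
    rintro ⟨a, b, p⟩ hp
    obtain rfl := Quiver.Path.eq_of_length_zero p hp
    exact ⟨a, by rw [Quiver.Path.eq_nil_of_length_zero p hp]; rfl⟩
  | succ n ih =>
    have := ih.to_subtype
    refine (Set.finite_range fun x : Σ p : {p : QuiverPath Q | p.length = n},
      Σ j : Q, (p.1.target ⟶ j) => (⟨x.1.1.source, x.2.1, x.1.1.path.cons x.2.2⟩ :
        QuiverPath Q)).subset ?_
    rintro ⟨a, b, p⟩ hp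
    cases p with
    | nil => exact absurd hp (Nat.succ_ne_zero n).symm
    | @cons c _ p f => exact ⟨⟨⟨⟨a, c, p⟩, Nat.succ_injective hp⟩, b, f⟩, rfl⟩

namespace PathAlgebra

variable {k : Type u} {Q : Type v} [Field k] [Quiver.{w} Q]

theorem basis_trivial_mul_basis (p : QuiverPath Q) :
    basis k Q (QuiverPath.trivial p.target) * basis k Q p = basis k Q p := by
  rw [basis_mul_basis, pathMul,
    dif_pos (show p.target = (QuiverPath.trivial p.target).source from rfl)]
  rfl

theorem basis_mul_basis_trivial (p : QuiverPath Q) :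
    basis k Q p * basis k Q (QuiverPath.trivial p.source) = basis k Q p := by
  rw [basis_mul_basis, pathMul,
    dif_pos (show (QuiverPath.trivial p.source).target = p.source from rfl)]
  exact congrArg _ (QuiverPath.comp_trivial p)

variable [Fintype Q]

section

variable (I : Ideal (PathAlgebra k Q)) [I.IsTwoSided]

theorem mk_mem_quotientGrading {n : ℕ} {x : PathAlgebra k Q} (hx : x ∈ grading k Q n) :
    Ideal.Quotient.mk I x ∈ quotientGrading I n :=
  ⟨x, hx, rfl⟩

instance : SetLike.GradedMonoid (quotientGrading I) where
  one_mem := mk_mem_quotientGrading I (SetLike.one_mem_graded _)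
  mul_mem := by
    rintro m n _ _ ⟨x, hx, rfl⟩ ⟨y, hy, rfl⟩
    exact mk_mem_quotientGrading I (SetLike.mul_mem_graded hx hy)

/-- Send an element of `kQ` to the family of the residue classes of its homogeneous components. -/
noncomputable def decomposeQuotientAux : PathAlgebra k Q →ₗ[k] ⨁ n, quotientGrading I n :=
  DirectSum.lmap (fun n => ((Ideal.Quotient.mkₐ k I).toLinearMap.submoduleMap (grading k Q n))) ∘ₗ
    (decomposeLinearEquiv (grading k Q)).toLinearMap

theorem coe_decomposeQuotientAux (x : PathAlgebra k Q) (n : ℕ) :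
    (decomposeQuotientAux I x n : PathAlgebra k Q ⧸ I) =
      Ideal.Quotient.mk I (decompose (grading k Q) x n : PathAlgebra k Q) := rfl

theorem decomposeQuotientAux_of_mem {n : ℕ} {x : PathAlgebra k Q} (hx : x ∈ grading k Q n) :
    decomposeQuotientAux I x =
      DirectSum.of (fun n => quotientGrading I n) n ⟨_, mk_mem_quotientGrading I hx⟩ := by
  refine DFinsupp.ext fun m => Subtype.ext ?_
  rw [coe_decomposeQuotientAux]
  by_cases h : n = m
  · subst h
    rw [decompose_of_mem_same _ hx, of_eq_same]
  · rw [decompose_of_mem_ne _ hx h, map_zero, of_eq_of_ne _ _ _ (Ne.symm h), Submodule.coe_zero]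

theorem decomposeQuotientAux_surjective : Function.Surjective (decomposeQuotientAux I) := by
  intro z
  induction z using DirectSum.induction_on with
  | zero => exact ⟨0, map_zero _⟩
  | of n z =>
    obtain ⟨_, x, hx, rfl⟩ := z
    exact ⟨x, decomposeQuotientAux_of_mem I hx⟩
  | add y z hy hz =>
    obtain ⟨x, rfl⟩ := hy
    obtain ⟨x', rfl⟩ := hz
    exact ⟨x + x', map_add _ _ _⟩

theorem coeAddMonoidHom_decomposeQuotientAux (x : PathAlgebra k Q) :
    DirectSum.coeAddMonoidHom (quotientGrading I) (decomposeQuotientAux I x) =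
      Ideal.Quotient.mk I x := by
  induction x using Decomposition.inductionOn (grading k Q) with
  | zero => simp
  | @homogeneous i x => rw [decomposeQuotientAux_of_mem I x.2, coeAddMonoidHom_of]
  | add x y hx hy => rw [map_add, map_add, hx, hy, map_add]

variable {I}

/-- The quotient of `kQ` by a homogeneous ideal is graded by the images of the homogeneous parts of
`kQ`: homogeneity says that congruent elements have congruent homogeneous components. -/
@[reducible]
noncomputable def quotientGradedAlgebra (hI : I.IsHomogeneous (grading k Q)) :
    GradedAlgebra (quotientGrading I) :=
  have hmk : ∀ x, decomposeQuotientAux I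
      (Function.surjInv Ideal.Quotient.mk_surjective (Ideal.Quotient.mk I x)) =
        decomposeQuotientAux I x := fun x => by
    refine DFinsupp.ext fun n => Subtype.ext ?_
    rw [coe_decomposeQuotientAux, coe_decomposeQuotientAux, Ideal.Quotient.eq,
      ← AddSubgroupClass.coe_sub, ← DirectSum.sub_apply, ← decompose_sub]
    exact hI n (Ideal.Quotient.eq.1 (Function.surjInv_eq _ _))
  { decompose' := fun x =>
      decomposeQuotientAux I (Function.surjInv Ideal.Quotient.mk_surjective x)
    left_inv := fun x => by
      rw [coeAddMonoidHom_decomposeQuotientAux]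
      exact Function.surjInv_eq _ x
    right_inv := fun z => by
      obtain ⟨x, rfl⟩ := decomposeQuotientAux_surjective I z
      rw [coeAddMonoidHom_decomposeQuotientAux]
      exact hmk x }

/-- The idempotent of `kQ/I` at a vertex. -/
noncomputable def vertex (I : Ideal (PathAlgebra k Q)) [I.IsTwoSided] (i : Q) :
    PathAlgebra k Q ⧸ I :=
  Ideal.Quotient.mk I (basis k Q (QuiverPath.trivial i))

variable (I) in
theorem completeOrthogonalIdempotents_vertex : CompleteOrthogonalIdempotents (vertex I) where
  idem i := by
    rw [IsIdempotentElem, vertex, ← map_mul]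
    exact congrArg _ (basis_trivial_mul_basis (QuiverPath.trivial i))
  ortho i j hij := by
    change vertex I i * vertex I j = 0
    rw [vertex, vertex, ← map_mul, basis_mul_basis, pathMul,
      dif_neg (show ¬ (QuiverPath.trivial j).target = (QuiverPath.trivial i).source from
        Ne.symm hij), map_zero]
  complete := by
    simp only [vertex]
    rw [← map_sum, ← one_def, map_one]

variable (I) in
theorem quotientGrading_zero :
    quotientGrading I 0 = Submodule.span k (Set.range (vertex I)) := by
  rw [quotientGrading, grading, Submodule.map_span]
  congr 1
  ext x
  constructor
  · rintro ⟨_, ⟨⟨a, b, p⟩, hp, rfl⟩, rfl⟩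
    obtain rfl := Quiver.Path.eq_of_length_zero p hp
    rw [Quiver.Path.eq_nil_of_length_zero p hp]
    exact ⟨a, rfl⟩
  · rintro ⟨i, rfl⟩
    exact ⟨_, ⟨_, rfl, rfl⟩, rfl⟩

/-- A path of length less than `n` does not vanish in `kQ/I` if `I` is contained in `kQ_{≥ n}`. -/
theorem mk_basis_ne_zero {n : ℕ} (hI : ∀ x ∈ I, x ∈ pathsGE k Q n) (p : QuiverPath Q)
    (hp : p.length < n) : Ideal.Quotient.mk I (basis k Q p) ≠ 0 := by
  rw [Ne, Ideal.Quotient.eq_zero_iff_mem]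
  intro h
  have h' := hI _ h
  rw [pathsGE, Module.Basis.mem_span_image] at h'
  have := h' (by simp : p ∈ (((basis k Q).repr (basis k Q p)).support : Set _))
  exact absurd hp (not_lt.2 this)

theorem nonempty_path_of_ne_zero {i j : Q} (b : PathAlgebra k Q ⧸ I)
    (hb : vertex I i * b * vertex I j ≠ 0) : Nonempty (Quiver.Path j i) := by
  by_contra hne
  apply hb
  obtain ⟨x, rfl⟩ := Ideal.Quotient.mk_surjective b
  rw [vertex, vertex, ← map_mul, ← map_mul]
  suffices h : (LinearMap.mulLeft k (basis k Q (QuiverPath.trivial i))).comp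
      (LinearMap.mulRight k (basis k Q (QuiverPath.trivial j))) = 0 by
    have := LinearMap.congr_fun h x
    rw [LinearMap.comp_apply, LinearMap.mulLeft_apply, LinearMap.mulRight_apply,
      ← mul_assoc] at this
    rw [this, LinearMap.zero_apply, map_zero]
  refine (basis k Q).ext fun p => ?_
  rw [LinearMap.comp_apply, LinearMap.mulLeft_apply, LinearMap.mulRight_apply, basis_mul_basis,
    pathMul, LinearMap.zero_apply]
  split_ifs with h
  · rw [basis_mul_basis, pathMul, dif_neg]
    obtain ⟨s, t, p⟩ := p
    intro h'
    obtain rfl : j = s := h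
    obtain rfl : t = i := h'
    exact hne ⟨p⟩
  · rw [mul_zero]

theorem finite_quotient [∀ i j : Q, Finite (i ⟶ j)] (hI : I.IsHomogeneous (grading k Q)) {d : ℕ}
    (hd : ∀ i, d < i → quotientGrading I i = ⊥) : Module.Finite k (PathAlgebra k Q ⧸ I) := by
  let _ := quotientGradedAlgebra hI
  have hfin : ∀ n, Module.Finite k (quotientGrading I n) := fun n => by
    rw [Module.Finite.iff_fg, quotientGrading, grading]
    exact (Submodule.fg_span ((QuiverPath.finite_setOf_length_eq n).image _)).map _
  rw [Module.finite_def, ← (Decomposition.isInternal (quotientGrading I)).submodule_iSup_eq_top,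
    show ⨆ n, quotientGrading I n = ⨆ n : Fin (d + 1), quotientGrading I n from ?_]
  · exact Submodule.fg_iSup _ fun n => Module.Finite.iff_fg.1 (hfin n)
  · refine le_antisymm (iSup_le fun n => ?_) (iSup_le fun n => le_iSup (quotientGrading I) n)
    rcases lt_or_ge d n with h | h
    · rw [hd n h]
      exact bot_le
    · exact le_iSup (fun n : Fin (d + 1) => quotientGrading I n) ⟨n, by omega⟩

end

/-! ### Degrees of the socles, and strong connectivity -/

section

variable {I : Ideal (PathAlgebra k Q)} [I.IsTwoSided] [GradedAlgebra (quotientGrading I)]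

/-- Along an arrow `i ⟶ j` the degree of the socle does not increase, and there is a path
from `ν j` to `i`. -/
theorem degree_le_of_hom (S : SocleData (quotientGrading I) (vertex I))
    (hI₂ : ∀ x ∈ I, x ∈ pathsGE k Q 2) {i j : Q} (α : i ⟶ j) :
    S.δ j ≤ S.δ i ∧ Nonempty (Quiver.Path (S.ν j) i) := by
  let p : QuiverPath Q := ⟨i, j, α.toPath⟩
  obtain ⟨hle, m, b, -, hb⟩ := S.degree_le_of_arrow (completeOrthogonalIdempotents_vertex I)
    (quotientGrading_zero I) (mk_mem_quotientGrading I (basis_mem_grading (k := k) p))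
    (mk_basis_ne_zero hI₂ p Nat.one_lt_two)
    (by rw [vertex, ← map_mul]; exact congrArg _ (basis_trivial_mul_basis p))
    (by rw [vertex, ← map_mul]; exact congrArg _ (basis_mul_basis_trivial p))
  exact ⟨hle, nonempty_path_of_ne_zero b hb⟩

/-- There are paths from `ν i` to `i`. Since `ν` is a permutation of a finite set, there also are
paths from `i` to `ν i`, and hence any arrow is part of an oriented cycle. -/
theorem isStronglyConnected (S : SocleData (quotientGrading I) (vertex I))
    (hI₂ : ∀ x ∈ I, x ∈ pathsGE k Q 2) (hQ : Quiver.IsConnected Q) :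
    Quiver.IsStronglyConnected Q := by
  have h₁ : ∀ i, Nonempty (Quiver.Path (S.ν i) i) := fun i =>
    nonempty_path_of_ne_zero (S.s i) (by rw [S.mul_s, S.s_mul]; exact S.s_ne_zero i)
  have h₂ : ∀ i n, Nonempty (Quiver.Path (S.ν^[n] i) i) := by
    intro i n
    induction n with
    | zero => exact ⟨Quiver.Path.nil⟩
    | succ n ih =>
      rw [Function.iterate_succ_apply']
      exact ⟨(h₁ _).some.comp ih.some⟩
  have h₃ : ∀ i, Nonempty (Quiver.Path i (S.ν i)) := by
    intro i
    obtain ⟨n, hn, hi⟩ := S.ν_injective.mem_periodicPts i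
    obtain ⟨m, rfl⟩ := Nat.exists_eq_succ_of_ne_zero hn.ne'
    have := h₂ (S.ν i) m
    rwa [← Function.iterate_succ_apply, hi] at this
  have h₄ : ∀ {i j : Q}, (i ⟶ j) → Nonempty (Quiver.Path j i) := fun {i j} α =>
    ⟨(h₃ j).some.comp (degree_le_of_hom S hI₂ α).2.some⟩
  intro i j
  obtain ⟨p⟩ := (Quiver.WeaklyConnectedComponent.eq i j).1 (hQ.2.elim _ _)
  induction p with
  | nil => exact ⟨Quiver.Path.nil⟩
  | cons _ α ih =>
    rcases α with α | α
    · exact ⟨ih.some.cons α⟩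
    · exact ⟨ih.some.comp (h₄ α).some⟩

theorem degree_eq (S : SocleData (quotientGrading I) (vertex I))
    (hI₂ : ∀ x ∈ I, x ∈ pathsGE k Q 2) (hQ : Quiver.IsConnected Q) {d : ℕ}
    (hd : quotientGrading I d ≠ ⊥) (hd' : ∀ i, d < i → quotientGrading I i = ⊥) (i : Q) :
    S.δ i = d := by
  have hle : ∀ i j, S.δ j ≤ S.δ i := by
    intro i j
    obtain ⟨p⟩ := isStronglyConnected S hI₂ hQ i j
    induction p with
    | nil => exact le_rfl
    | cons _ α ih => exact (degree_le_of_hom S hI₂ α).1.trans ih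
  apply le_antisymm
  · by_contra! h
    have := S.s_mem i
    rw [hd' _ h, Submodule.mem_bot] at this
    exact S.s_ne_zero i this
  · obtain ⟨x, hx, hx₀⟩ := Submodule.exists_mem_ne_zero_of_ne_bot hd
    have he := completeOrthogonalIdempotents_vertex I
    obtain ⟨j, hj⟩ := exists_mul_ne_zero_left he hx₀
    have hmem := SetLike.mul_mem_graded (A := quotientGrading I)
      (mk_mem_quotientGrading I (basis_mem_grading (k := k) (QuiverPath.trivial j))) hx
    rw [show (QuiverPath.trivial j).length + d = d from zero_add d] at hmem
    exact (S.le_degree hmem hj (by rw [← mul_assoc]; exact congrArg (· * x) (he.idem j))).trans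
      (hle i j)

end

end PathAlgebra

theorem proposition5p3 {k : Type*} [Field k] {Q : Type*} [Quiver Q] [Fintype Q]
    [∀ i j : Q, Finite (i ⟶ j)] (hQ : Quiver.IsConnected Q)
    (I : Ideal (PathAlgebra k Q)) [I.IsTwoSided]
    (hI : I.IsHomogeneous (PathAlgebra.grading k Q))
    (hI₂ : ∀ x ∈ I, x ∈ PathAlgebra.pathsGE k Q 2)
    (d : ℕ) (hd : HasGradedLength (PathAlgebra.quotientGrading I) (d + 1))
    (hinj : IsGradedSelfInjective (PathAlgebra.quotientGrading I)) :
    IsGradedFrobenius d (PathAlgebra.quotientGrading I) ∧ Quiver.IsStronglyConnected Q := by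
  obtain ⟨d', hdd', hd, hd'⟩ := hd
  obtain rfl : d = d' := Nat.succ_injective hdd'
  let _ := PathAlgebra.quotientGradedAlgebra hI
  have := PathAlgebra.finite_quotient hI hd'
  have he := PathAlgebra.completeOrthogonalIdempotents_vertex I
  have h₀ := PathAlgebra.quotientGrading_zero I
  obtain ⟨S⟩ := hinj.nonempty_socleData he h₀
    (fun i => PathAlgebra.mk_basis_ne_zero hI₂ (QuiverPath.trivial i) Nat.zero_lt_two) hd'
  exact ⟨S.isGradedFrobenius he h₀ (PathAlgebra.degree_eq S hI₂ hQ hd hd'),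
    PathAlgebra.isStronglyConnected S hI₂ hQ⟩
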